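/- For a composition $\mathbf s=(s_1,\dots,s_r)$ of positive integers, complex numbers $\xi=(\xi_1,\dots,\xi_r)$ and real parameters $\mathbf t=(t_1,\dots,t_r)$, the colored Hurwitz polyzêta is $$\mathrm{Di}(\mathbf F_{\xi,\mathbf t};\mathbf s)=\sum_{n_1>\dots>n_r>0}\frac{\xi_1^{n_1}\cdots\xi_r^{n_r}}{(n_1-t_1)^{s_1}\cdots(n_r-t_r)^{s_r}},$$ where for $r=0$ the value is $1$; $\mathbf s$ is called convergent if $r=0$ or $s_1>1$. **Theorem.** Let $T\subset\mathbb R$, let $\mathcal T$ be the additive group generated by $T$, let $\mathcal C$ be a subgroup of $\mathbb C^*$ and $A$ a subring of $\mathbb C$. Let $\mathcal C'$ be the set of finite tuples $(\xi_1,\dots,\xi_r)$ of elements of $\mathcal C$ with $|\xi_1\cdots\xi_i|\le 1$ for all $i$. Let $\mathcal T'$ be either (a) the set of finite tuples $(t_1,\dots,t_r)$ of elements of $\mathcal T$ such that all the numbers $n_i-t_i$ occurring in the series are positive, that is, $t_i<r-i+1$ for all $i$ (this contains all tuples of elements of $\mathcal T\cap\,]-\infty,1[$), or (b) the set of all finite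 tuples of elements of $\mathcal T$, provided that $\mathcal T$ contains no positive integer. Then for $\xi\in\mathcal C'$, $\mathbf t\in\mathcal T'$ and convergent $\mathbf s$ of the same length $r$ the series $\mathrm{Di}(\mathbf F_{\xi,\mathbf t};\mathbf s)$ converges absolutely, and the $A$-algebra generated by all these numbers is equal to the $A$-module generated by them. This holds both for algebras with unit, with the value $1$ of depth $r=0$ among the generators, and for algebras without unit, with only the generators of depth $r\ge 1$. -/

import Mathlib

open scoped BigOperators

/-- The index set `n₁ > n₂ > ⋯ > n_r > 0` of the series. For `r = 0` it consists of the empty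
tuple only. -/
def DecreasingIndex (r : ℕ) : Type :=
  {n : Fin r → ℕ // StrictAnti n ∧ ∀ i, 0 < n i}

/-- The general term `∏ ξ_i ^ n_i / (n_i - t_i) ^ s_i`. -/
noncomputable def hurwitzTerm {r : ℕ} (ξ : Fin r → ℂ) (t : Fin r → ℝ) (s : Fin r → ℕ)
    (n : DecreasingIndex r) : ℂ :=
  ∏ i, ξ i ^ n.1 i / (((n.1 i : ℝ) - t i : ℝ) : ℂ) ^ s i

/-- The colored Hurwitz polyzeta `Di(F_{ξ,t}; s)`. In depth `r = 0` its value is `1`. -/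
noncomputable def coloredHurwitz {r : ℕ} (ξ : Fin r → ℂ) (t : Fin r → ℝ) (s : Fin r → ℕ) : ℂ :=
  ∑' n : DecreasingIndex r, hurwitzTerm ξ t s n

/-- Convergent compositions: positive integers `s₁, …, s_r` with `s₁ > 1`. -/
def convergentCompositions (r : ℕ) : Set (Fin r → ℕ) :=
  {s | (∀ i, 0 < s i) ∧ ∀ h : 0 < r, 1 < s ⟨0, h⟩}

/-- The tuples `(ξ₁, …, ξ_r)` with entries in `𝒞` all of whose partial products
`ξ₁ ⋯ ξ_i` have modulus at most `1`. -/
def colorTuples (𝒞 : Subgroup ℂˣ) (r : ℕ) : Set (Fin r → ℂ) :=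
  {ξ | (∀ i, ∃ c ∈ 𝒞, (c : ℂ) = ξ i) ∧ ∀ i, ‖∏ k ∈ Finset.Iic i, ξ k‖ ≤ 1}

/-- All `r`-tuples with entries in `𝒯`. -/
def allTuples (𝒯 : AddSubgroup ℝ) (r : ℕ) : Set (Fin r → ℝ) :=
  {t | ∀ i, t i ∈ 𝒯}

/-- The `r`-tuples with entries in `𝒯` for which all the numbers `n_i - t_i` occurring in the
series are positive. As the least possible value of `n_i` is `r - i + 1` (with `i` counted from
`1`), this says `t_i < r - i + 1`; in particular it holds if all `t_i` are less than `1`. -/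
def positiveTuples (𝒯 : AddSubgroup ℝ) (r : ℕ) : Set (Fin r → ℝ) :=
  {t | (∀ i, t i ∈ 𝒯) ∧ ∀ n : DecreasingIndex r, ∀ i, t i < (n.1 i : ℝ)}

/-- The colored Hurwitz polyzetas of depth at least `d` with colors in `𝒞` and parameter tuples
in the family `𝒯'`. -/
def polyzetas (d : ℕ) (𝒞 : Subgroup ℂˣ) (𝒯' : (r : ℕ) → Set (Fin r → ℝ)) : Set ℂ :=
  {z | ∃ r : ℕ, d ≤ r ∧ ∃ ξ ∈ colorTuples 𝒞 r, ∃ t ∈ 𝒯' r, ∃ s ∈ convergentCompositions r,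
    z = coloredHurwitz ξ t s}

/-! Summing by the largest index turns a polyzeta into the value at `X = 1` of a power series. That
series is an iterated integral: it is built from `1` by multiplying with a letter (`1` or `∑ η ^ N X
^ N`) and then inverting `θ - t`, where `θ = X d/dX`. The parameters `η` are the partial products of
the colors, hence the condition on their moduli. Since `(θ - t - u)(FG) = ((θ - t)F) G + F ((θ -
u)G)`, such series multiply by a shuffle rule (`divSeries_mul_divSeries`,
`IsWordSeries.mul_mem_span`). A letter carries the difference of consecutive parameters, so depth
and shift of a word are sums over its letters and are preserved by shuffling. Only an additive
condition `Q` on (depth, shift) of suffixes is needed; it must also exclude zero denominators, which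
is enough to check for `N ≥ d` because a word of depth `d` is divisible by `X ^ d`. Convergent
polyzetas correspond to words beginning with the letter `1`, a property the shuffle keeps. Absolute
convergence lets Cauchy products be evaluated at `X = 1`. -/

open PowerSeries

/-! ### Words as iterated integrals -/

/-- The power series whose `N`-th coefficient is that of `f` divided by `(N - t) ^ k`. -/
noncomputable def divSeries (t : ℝ) (k : ℕ) : ℂ⟦X⟧ →ₗ[ℂ] ℂ⟦X⟧ where
  toFun f := PowerSeries.mk fun N => coeff N f / (((N : ℝ) - t : ℝ) : ℂ) ^ k
  map_add' f g := by ext N; simp [add_div]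
  map_smul' a f := by ext N; simp [mul_div_assoc]

/-- The power series `∑_{N ≥ 1} η ^ N X ^ N`. -/
noncomputable def geomSeries (η : ℂ) : ℂ⟦X⟧ := PowerSeries.mk fun N => if N = 0 then 0 else η ^ N

@[simp] lemma coeff_divSeries (t : ℝ) (k : ℕ) (f : ℂ⟦X⟧) (N : ℕ) :
    coeff N (divSeries t k f) = coeff N f / (((N : ℝ) - t : ℝ) : ℂ) ^ k := by
  simp [divSeries]

lemma divSeries_divSeries (t : ℝ) (j k : ℕ) (f : ℂ⟦X⟧) :
    divSeries t j (divSeries t k f) = divSeries t (k + j) f := by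
  ext N; simp [div_div, pow_add]

/-- The missing constant term of `geomSeries` makes the sum run over `k < N`: this is the strict
inequality between consecutive indices. -/
lemma coeff_geomSeries_mul (η : ℂ) (f : ℂ⟦X⟧) (N : ℕ) :
    coeff N (geomSeries η * f) = ∑ k ∈ Finset.range N, η ^ (N - k) * coeff k f := by
  rw [mul_comm, coeff_mul, Finset.Nat.sum_antidiagonal_eq_sum_range_succ_mk,
    Finset.sum_range_succ]
  simp only [geomSeries, coeff_mk, Nat.sub_self, if_true, mul_zero, add_zero]
  refine Finset.sum_congr rfl fun k hk => ?_
  rw [if_neg (by have := Finset.mem_range.1 hk; omega), mul_comm]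

lemma X_dvd_geomSeries (η : ℂ) : (X : ℂ⟦X⟧) ∣ geomSeries η := by
  rw [X_dvd_iff]; simp [geomSeries]

/-- The series `1` and `∑ η ^ N X ^ N` attached to the letters of a word, together with their
contributions to the depth and to the shift of the word. -/
inductive IsLetter (𝒞 : Subgroup ℂˣ) : ℕ → ℝ → ℂ⟦X⟧ → Prop
  | zero : IsLetter 𝒞 0 0 1
  | pos (τ : ℝ) (η : ℂˣ) (hη : η ∈ 𝒞) (h : ‖(η : ℂ)‖ ≤ 1) : IsLetter 𝒞 1 τ (geomSeries η)

/-- The power series attached to words, with the depth and the shift of the word. -/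
inductive IsWordSeries (𝒞 : Subgroup ℂˣ) (Q : ℕ → ℝ → Prop) : ℕ → ℝ → ℂ⟦X⟧ → Prop
  | one : IsWordSeries 𝒞 Q 0 0 1
  | step {d : ℕ} {t : ℝ} {f : ℂ⟦X⟧} {δ : ℕ} {τ : ℝ} {G : ℂ⟦X⟧} (hf : IsWordSeries 𝒞 Q d t f)
      (hG : IsLetter 𝒞 δ τ G) (hQ : Q (d + δ) (t + τ)) :
      IsWordSeries 𝒞 Q (d + δ) (t + τ) (divSeries (t + τ) 1 (G * f))

/-- The condition on pairs (depth, shift) under which words can be multiplied. -/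
structure ShiftCondition (Q : ℕ → ℝ → Prop) : Prop where
  pos : ∀ {d t}, Q d t → 0 < d
  ne : ∀ {d t}, Q d t → ∀ N : ℕ, d ≤ N → (N : ℝ) ≠ t
  add : ∀ {d t d' t'}, Q d t → Q d' t' → Q (d + d') (t + t')

lemma IsLetter.X_pow_dvd {𝒞 : Subgroup ℂˣ} {δ : ℕ} {τ : ℝ} {G : ℂ⟦X⟧} (h : IsLetter 𝒞 δ τ G) :
    (X : ℂ⟦X⟧) ^ δ ∣ G := by
  cases h with
  | zero => simp
  | pos η => simpa using X_dvd_geomSeries _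

lemma X_pow_dvd_divSeries {t : ℝ} {k d : ℕ} {f : ℂ⟦X⟧} (h : (X : ℂ⟦X⟧) ^ d ∣ f) :
    (X : ℂ⟦X⟧) ^ d ∣ divSeries t k f := by
  rw [X_pow_dvd_iff] at h ⊢
  intro m hm
  simp [h m hm]

lemma IsWordSeries.X_pow_dvd {𝒞 : Subgroup ℂˣ} {Q : ℕ → ℝ → Prop} {d : ℕ} {t : ℝ} {f : ℂ⟦X⟧}
    (h : IsWordSeries 𝒞 Q d t f) : (X : ℂ⟦X⟧) ^ d ∣ f := by
  induction h with
  | one => simp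
  | step hf hG hQ ih =>
    refine X_pow_dvd_divSeries ?_
    rw [pow_add, mul_comm]
    exact mul_dvd_mul hG.X_pow_dvd ih

/-- `(N - t) c_N = a_N`, where `c_N` are the coefficients of `divSeries t 1 f` and `a_N` those
of `f`. -/
lemma mul_coeff_divSeries {Q : ℕ → ℝ → Prop} (hQ : ShiftCondition Q) {d : ℕ} {t : ℝ}
    (h : Q d t) {f : ℂ⟦X⟧} (hf : (X : ℂ⟦X⟧) ^ d ∣ f) (N : ℕ) :
    ((N : ℂ) - t) * coeff N (divSeries t 1 f) = coeff N f := by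
  rcases lt_or_ge N d with hN | hN
  · simp [X_pow_dvd_iff.1 hf N hN]
  · have h0 : ((N : ℂ) - t) ≠ 0 := by
      have := hQ.ne h N hN
      exact_mod_cast sub_ne_zero.2 this
    simp only [coeff_divSeries, pow_one, Complex.ofReal_sub, Complex.ofReal_natCast]
    field_simp

/-- The Leibniz rule behind the shuffle product. -/
lemma divSeries_mul_divSeries {Q : ℕ → ℝ → Prop} (hQ : ShiftCondition Q) {d e : ℕ} {t u : ℝ}
    (hd : Q d t) (he : Q e u) {f g : ℂ⟦X⟧} (hf : (X : ℂ⟦X⟧) ^ d ∣ f) (hg : (X : ℂ⟦X⟧) ^ e ∣ g) :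
    divSeries t 1 f * divSeries u 1 g =
      divSeries (t + u) 1 (f * divSeries u 1 g) + divSeries (t + u) 1 (divSeries t 1 f * g) := by
  have hf' : (X : ℂ⟦X⟧) ^ d ∣ divSeries t 1 f := X_pow_dvd_divSeries hf
  have hg' : (X : ℂ⟦X⟧) ^ e ∣ divSeries u 1 g := X_pow_dvd_divSeries hg
  rw [← map_add]
  have hdvd : (X : ℂ⟦X⟧) ^ (d + e) ∣ f * divSeries u 1 g + divSeries t 1 f * g := by
    rw [pow_add]
    exact dvd_add (mul_dvd_mul hf hg') (mul_dvd_mul hf' hg)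
  have hdvd' : (X : ℂ⟦X⟧) ^ (d + e) ∣ divSeries t 1 f * divSeries u 1 g := by
    rw [pow_add]
    exact mul_dvd_mul hf' hg'
  ext N
  rcases lt_or_ge N (d + e) with hN | hN
  · rw [X_pow_dvd_iff.1 hdvd' N hN, coeff_divSeries, X_pow_dvd_iff.1 hdvd N hN, zero_div]
  · have hne := hQ.ne (hQ.add hd he) N hN
    have h0 : ((N : ℂ) - (t + u : ℝ)) ≠ 0 := by exact_mod_cast sub_ne_zero.2 hne
    refine mul_left_cancel₀ h0 ?_
    rw [mul_coeff_divSeries hQ (hQ.add hd he) hdvd, map_add, coeff_mul, coeff_mul, coeff_mul,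
      Finset.mul_sum, ← Finset.sum_add_distrib]
    refine Finset.sum_congr rfl fun p hp => ?_
    rw [← mul_coeff_divSeries hQ hd hf, ← mul_coeff_divSeries hQ he hg,
      -- With `N = p.1 + p.2`, the factor `N - (t + u)` splits as `(p.1 - t) + (p.2 - u)`.
      ← Finset.HasAntidiagonal.mem_antidiagonal.1 hp]
    push_cast
    ring

/-! ### The shuffle product -/

section Product

variable (A : Subring ℂ) {𝒞 : Subgroup ℂˣ} {Q : ℕ → ℝ → Prop}

lemma divSeries_mem_span {t : ℝ} {S S' : Set ℂ⟦X⟧} {G : ℂ⟦X⟧}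
    (h : ∀ f ∈ S, divSeries t 1 (G * f) ∈ S') {f : ℂ⟦X⟧} (hf : f ∈ Submodule.span A S) :
    divSeries t 1 (G * f) ∈ Submodule.span A S' := by
  induction hf using Submodule.span_induction with
  | mem f hf => exact Submodule.subset_span (h f hf)
  | zero => simp
  | add f g _ _ hf hg => rw [mul_add, map_add]; exact add_mem hf hg
  | smul a f _ hf =>
    have : divSeries t 1 (G * (a • f)) = a • divSeries t 1 (G * f) := by
      rw [mul_smul_comm]
      exact (divSeries t 1).map_smul (a : ℂ) _
    rw [this]
    exact Submodule.smul_mem _ _ hf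

/-- Shuffle recursion: the Leibniz rule takes the first letter off one of the two words, induction
expands the remaining product, and the letter is put back in front. Total depth and shift do not
change, so `hQ.add` licenses the new division. -/
lemma IsWordSeries.mul_mem_span (hQ : ShiftCondition Q) {d : ℕ} {t : ℝ} {f : ℂ⟦X⟧}
    (hf : IsWordSeries 𝒞 Q d t f) {e : ℕ} {u : ℝ} {g : ℂ⟦X⟧} (hg : IsWordSeries 𝒞 Q e u g) :
    f * g ∈ Submodule.span A {h | IsWordSeries 𝒞 Q (d + e) (t + u) h} := by
  induction hf generalizing e u g with
  | one => exact Submodule.subset_span (by simpa using hg)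
  | @step d t f δ τ G hf hG hd ihf =>
    have hfs := hf.step hG hd
    induction hg with
    | one => exact Submodule.subset_span (by simpa using hfs)
    | @step e u g ε σ H hg hH he ihg =>
      have hgs := hg.step hH he
      have hfd : (X : ℂ⟦X⟧) ^ (d + δ) ∣ G * f := by
        rw [pow_add, mul_comm]; exact mul_dvd_mul hG.X_pow_dvd hf.X_pow_dvd
      have hgd : (X : ℂ⟦X⟧) ^ (e + ε) ∣ H * g := by
        rw [pow_add, mul_comm]; exact mul_dvd_mul hH.X_pow_dvd hg.X_pow_dvd
      have hde := hQ.add hd he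
      rw [divSeries_mul_divSeries hQ hd he hfd hgd]
      refine add_mem ?_ ?_
      · rw [mul_assoc]
        refine divSeries_mem_span A (fun h hh => ?_) (ihf hgs)
        have e1 : d + δ + (e + ε) = d + (e + ε) + δ := by ring
        have e2 : t + τ + (u + σ) = t + (u + σ) + τ := by ring
        rw [e1, e2] at hde ⊢
        exact IsWordSeries.step hh hG hde
      · rw [mul_left_comm]
        refine divSeries_mem_span A (fun h hh => ?_) ihg
        have e1 : d + δ + (e + ε) = d + δ + e + ε := by ring
        have e2 : t + τ + (u + σ) = t + τ + u + σ := by ring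
        rw [e1, e2] at hde ⊢
        exact IsWordSeries.step hh hH hde

/-- The series of words that start with the letter of depth `0`. -/
def convergentWordSeries (𝒞 : Subgroup ℂˣ) (Q : ℕ → ℝ → Prop) : Set ℂ⟦X⟧ :=
  {f | ∃ d t g, IsWordSeries 𝒞 Q d t g ∧ Q d t ∧ f = divSeries t 1 g}

/-- Whichever first letter the Leibniz rule removes is the letter `1`, so every word in the product
again begins with it. -/
lemma convergentWordSeries_mul_mem_span (hQ : ShiftCondition Q) {f g : ℂ⟦X⟧}
    (hf : f ∈ convergentWordSeries 𝒞 Q) (hg : g ∈ convergentWordSeries 𝒞 Q) :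
    f * g ∈ Submodule.span A (convergentWordSeries 𝒞 Q) := by
  obtain ⟨d, t, f, hf, hd, rfl⟩ := hf
  obtain ⟨e, u, g, hg, he, rfl⟩ := hg
  have hfs : IsWordSeries 𝒞 Q d t (divSeries t 1 f) := by
    simpa using hf.step IsLetter.zero (by simpa using hd)
  have hgs : IsWordSeries 𝒞 Q e u (divSeries u 1 g) := by
    simpa using hg.step IsLetter.zero (by simpa using he)
  rw [divSeries_mul_divSeries hQ hd he hf.X_pow_dvd hg.X_pow_dvd]
  have key : ∀ h ∈ Submodule.span A {h | IsWordSeries 𝒞 Q (d + e) (t + u) h},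
      divSeries (t + u) 1 h ∈ Submodule.span A (convergentWordSeries 𝒞 Q) := fun h hh => by
    simpa using divSeries_mem_span A (G := 1) (t := t + u) (S' := convergentWordSeries 𝒞 Q)
      (fun h hh => ⟨_, _, h, hh, hQ.add hd he, by simp⟩) hh
  exact add_mem (key _ (hf.mul_mem_span A hQ hgs)) (key _ (hfs.mul_mem_span A hQ hg))

end Product

/-! ### Dictionary between words and polyzetas -/

/-- The power series whose `N`-th coefficient is `c ^ N` times the part `n₁ = N` of the colored
Hurwitz polyzeta. -/
noncomputable def hurwitzSeries :
    (r : ℕ) → ℂ → (Fin r → ℂ) → (Fin r → ℝ) → (Fin r → ℕ) → ℂ⟦X⟧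
  | 0, _, _, _, _ => 1
  | r + 1, c, ξ, t, s => divSeries (t 0) (s 0)
      (geomSeries (c * ξ 0) * hurwitzSeries r (c * ξ 0) (Fin.tail ξ) (Fin.tail t) (Fin.tail s))

/-- The data of an admissible polyzeta, with the first color multiplied by `c`. -/
def IsAdmissible (𝒞 : Subgroup ℂˣ) (Q : ℕ → ℝ → Prop) (r : ℕ) (c : ℂ) (ξ : Fin r → ℂ)
    (t : Fin r → ℝ) (s : Fin r → ℕ) : Prop :=
  ∀ i, (∃ x ∈ 𝒞, (x : ℂ) = ξ i) ∧ ‖c * ∏ k ∈ Finset.Iic i, ξ k‖ ≤ 1 ∧ Q (r - i) (t i) ∧ 0 < s i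

lemma prod_Iic_fin_zero {M : Type*} [CommMonoid M] {r : ℕ} (ξ : Fin (r + 1) → M) :
    ∏ k ∈ Finset.Iic 0, ξ k = ξ 0 := by
  have : (Finset.Iic 0 : Finset (Fin (r + 1))) = {0} := by ext k; simp
  simp [this]

lemma prod_Iic_fin_succ {M : Type*} [CommMonoid M] {r : ℕ} (ξ : Fin (r + 1) → M) (i : Fin r) :
    ∏ k ∈ Finset.Iic i.succ, ξ k = ξ 0 * ∏ k ∈ Finset.Iic i, Fin.tail ξ k := by
  have : (Finset.Iic i.succ : Finset (Fin (r + 1))) =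
      insert 0 ((Finset.Iic i).map (Fin.succEmb r)) := by
    ext k
    refine Fin.cases ?_ (fun k => ?_) k <;> simp
  rw [this, Finset.prod_insert (by simp), Finset.prod_map]
  rfl

lemma isAdmissible_succ {𝒞 : Subgroup ℂˣ} {Q : ℕ → ℝ → Prop} {r : ℕ} {c : ℂ} {ξ : Fin (r + 1) → ℂ}
    {t : Fin (r + 1) → ℝ} {s : Fin (r + 1) → ℕ} :
    IsAdmissible 𝒞 Q (r + 1) c ξ t s ↔
      ((∃ x ∈ 𝒞, (x : ℂ) = ξ 0) ∧ ‖c * ξ 0‖ ≤ 1 ∧ Q (r + 1) (t 0) ∧ 0 < s 0) ∧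
        IsAdmissible 𝒞 Q r (c * ξ 0) (Fin.tail ξ) (Fin.tail t) (Fin.tail s) := by
  unfold IsAdmissible
  rw [Fin.forall_fin_succ, prod_Iic_fin_zero]
  simp only [prod_Iic_fin_succ, ← mul_assoc]
  simp [Fin.tail]

lemma IsWordSeries.divSeries_of_pos {𝒞 : Subgroup ℂˣ} {Q : ℕ → ℝ → Prop} {d : ℕ} {t u : ℝ}
    {f : ℂ⟦X⟧} (hf : IsWordSeries 𝒞 Q d t f) {x : ℂˣ} (hx : x ∈ 𝒞) (hx1 : ‖(x : ℂ)‖ ≤ 1)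
    (hd : Q (d + 1) u) (k : ℕ) :
    IsWordSeries 𝒞 Q (d + 1) u (divSeries u (k + 1) (geomSeries x * f)) := by
  induction k with
  | zero =>
    -- The letter's shift is the jump from the suffix's shift `t` to `u`.
    simpa using hf.step (IsLetter.pos (u - t) x hx hx1) (by simpa using hd)
  | succ k ih =>
    simpa [divSeries_divSeries] using ih.step IsLetter.zero (by simpa using hd)

lemma exists_isWordSeries_hurwitzSeries {𝒞 : Subgroup ℂˣ} {Q : ℕ → ℝ → Prop} (r : ℕ) (c : ℂˣ)
    (hc : c ∈ 𝒞) (ξ : Fin r → ℂ) (t : Fin r → ℝ) (s : Fin r → ℕ)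
    (h : IsAdmissible 𝒞 Q r c ξ t s) :
    ∃ u, IsWordSeries 𝒞 Q r u (hurwitzSeries r c ξ t s) := by
  induction r generalizing c with
  | zero => exact ⟨0, IsWordSeries.one⟩
  | succ r ih =>
    obtain ⟨⟨⟨x, hx, hx'⟩, h1, h2, h3⟩, h4⟩ := isAdmissible_succ.1 h
    rw [← hx', ← Units.val_mul] at h1 h4
    obtain ⟨u, hu⟩ := ih (c * x) (mul_mem hc hx) _ _ _ h4
    have := hu.divSeries_of_pos (mul_mem hc hx) h1 h2 (s 0 - 1)
    rw [Nat.sub_add_cancel h3] at this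
    exact ⟨t 0, by simpa [hurwitzSeries, hx'] using this⟩

lemma hurwitzSeries_mem_convergentWordSeries {𝒞 : Subgroup ℂˣ} {Q : ℕ → ℝ → Prop} (r : ℕ)
    (ξ : Fin (r + 1) → ℂ) (t : Fin (r + 1) → ℝ) (s : Fin (r + 1) → ℕ)
    (h : IsAdmissible 𝒞 Q (r + 1) 1 ξ t s) (hs : 1 < s 0) :
    hurwitzSeries (r + 1) 1 ξ t s ∈ convergentWordSeries 𝒞 Q := by
  obtain ⟨⟨⟨x, hx, hx'⟩, h1, h2, h3⟩, h4⟩ := isAdmissible_succ.1 h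
  rw [one_mul, ← hx'] at h1 h4
  obtain ⟨u, hu⟩ := exists_isWordSeries_hurwitzSeries r x hx _ _ _ h4
  refine ⟨_, _, _, hu.divSeries_of_pos hx h1 h2 (s 0 - 2), h2, ?_⟩
  rw [divSeries_divSeries, show s 0 - 2 + 1 + 1 = s 0 by omega]
  simp [hurwitzSeries, hx']

/-- A letter `1` raises the first exponent by one; a letter with parameter `η` opens a new index
with exponent `1`. Here `c` is the product of the preceding colors, so the new color is `c⁻¹ * η`,
which lies in the group. -/
lemma IsWordSeries.exists_eq_hurwitzSeries {𝒞 : Subgroup ℂˣ} {Q : ℕ → ℝ → Prop}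
    (hQ : ShiftCondition Q) {d : ℕ} {u : ℝ} {f : ℂ⟦X⟧} (hf : IsWordSeries 𝒞 Q d u f)
    (c : ℂˣ) (hc : c ∈ 𝒞) :
    ∃ ξ t s, IsAdmissible 𝒞 Q d c ξ t s ∧ f = hurwitzSeries d c ξ t s ∧
      ∀ h : 0 < d, t ⟨0, h⟩ = u := by
  induction hf generalizing c with
  | one => exact ⟨0, 0, 0, fun i => i.elim0, rfl, fun h => absurd h (lt_irrefl _)⟩
  | @step d v f δ τ G hf hG hd ih =>
    cases hG with
    | zero =>
      obtain ⟨ξ, t, s, h1, rfl, h2⟩ := ih c hc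
      have hd0 : 0 < d := hQ.pos hd
      obtain ⟨r, rfl⟩ : ∃ r, d = r + 1 := ⟨d - 1, by omega⟩
      have ht : t 0 = v := h2 hd0
      refine ⟨ξ, t, Fin.cons (s 0 + 1) (Fin.tail s), ?_, ?_, fun _ => by simpa using ht⟩
      · have := isAdmissible_succ.1 h1
        refine isAdmissible_succ.2 ?_
        simpa [this.1.2.2.2] using this
      · simp [hurwitzSeries, divSeries_divSeries, ht]
    | pos _ η hη h =>
      obtain ⟨ξ, t, s, h1, rfl, h2⟩ := ih η hη
      have hcη : (c : ℂ) * ((c⁻¹ * η : ℂˣ) : ℂ) = η := by simp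
      refine ⟨Fin.cons ((c⁻¹ * η : ℂˣ) : ℂ) ξ, Fin.cons (v + τ) t, Fin.cons 1 s, ?_, ?_,
        fun _ => rfl⟩
      · refine isAdmissible_succ.2 ?_
        simp only [Fin.cons_zero, Fin.tail_cons, hcη]
        exact ⟨⟨⟨_, mul_mem (inv_mem hc) hη, rfl⟩, h, hd, one_pos⟩, h1⟩
      · simp only [hurwitzSeries, Fin.cons_zero, Fin.tail_cons, hcη]

lemma exists_eq_hurwitzSeries_of_mem_convergentWordSeries {𝒞 : Subgroup ℂˣ} {Q : ℕ → ℝ → Prop}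
    (hQ : ShiftCondition Q) {f : ℂ⟦X⟧} (hf : f ∈ convergentWordSeries 𝒞 Q) :
    ∃ r ξ t s, IsAdmissible 𝒞 Q (r + 1) 1 ξ t s ∧ 1 < s 0 ∧ f = hurwitzSeries (r + 1) 1 ξ t s := by
  obtain ⟨d, u, g, hg, hd, rfl⟩ := hf
  obtain ⟨ξ, t, s, h1, rfl, h2⟩ := hg.exists_eq_hurwitzSeries hQ 1 (one_mem _)
  have hd0 : 0 < d := hQ.pos hd
  obtain ⟨r, rfl⟩ : ∃ r, d = r + 1 := ⟨d - 1, by omega⟩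
  have ht : t 0 = u := h2 hd0
  rw [Units.val_one] at h1 ⊢
  have h3 := isAdmissible_succ.1 h1
  refine ⟨r, ξ, t, Fin.cons (s 0 + 1) (Fin.tail s), ?_, ?_, ?_⟩
  · refine isAdmissible_succ.2 ?_
    simpa [h3.1.2.2.2] using h3
  · simpa using h3.1.2.2.2
  · simp [hurwitzSeries, divSeries_divSeries, ht]

/-! ### Summation by the largest index -/

/-- The largest index `n₁`, which is `0` in depth `0`. -/
def DecreasingIndex.top : {r : ℕ} → DecreasingIndex r → ℕ
  | 0, _ => 0
  | _ + 1, n => n.1 0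

/-- Add an index in front. -/
def DecreasingIndex.cons {r N : ℕ} (n : DecreasingIndex r) (h : n.top < N) :
    DecreasingIndex (r + 1) :=
  ⟨Fin.cons N n.1, by
    refine ⟨?_, ?_⟩
    · cases r with
      | zero => exact fun i j hij => by have : (i : ℕ) < j := hij; omega
      | succ r =>
        rw [Fin.strictAnti_iff_succ_lt]
        intro i
        refine Fin.cases ?_ (fun i => ?_) i
        · have : n.1 0 < N := h
          simpa using this
        · simpa using n.2.1 (Fin.castSucc_lt_succ (i := i))
    · intro i
      refine Fin.cases ?_ (fun i => ?_) i
      · simp only [Fin.cons_zero]; omega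
      · simpa using n.2.2 i⟩

lemma DecreasingIndex.exists_eq_cons {r : ℕ} (n : DecreasingIndex (r + 1)) :
    ∃ (m : DecreasingIndex r) (h : m.top < n.top), n = m.cons h := by
  refine ⟨⟨Fin.tail n.1, fun i j hij => n.2.1 (Fin.succ_lt_succ_iff.2 hij),
    fun i => n.2.2 i.succ⟩, ?_, ?_⟩
  · cases r with
    | zero => exact n.2.2 0
    | succ r => exact n.2.1 (Fin.succ_pos 0)
  · exact Subtype.ext (Fin.cons_self_tail n.1).symm

lemma hurwitzTerm_cons {r N : ℕ} (ξ : Fin (r + 1) → ℂ) (t : Fin (r + 1) → ℝ)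
    (s : Fin (r + 1) → ℕ) (n : DecreasingIndex r) (h : n.top < N) :
    hurwitzTerm ξ t s (n.cons h) = ξ 0 ^ N / (((N : ℝ) - t 0 : ℝ) : ℂ) ^ s 0 *
      hurwitzTerm (Fin.tail ξ) (Fin.tail t) (Fin.tail s) n := by
  simp only [hurwitzTerm, Fin.prod_univ_succ]
  rfl

lemma hasSum_coeff_hurwitzSeries (r : ℕ) (c : ℂ) (ξ : Fin r → ℂ) (t : Fin r → ℝ)
    (s : Fin r → ℕ) (N : ℕ) :
    HasSum ({n : DecreasingIndex r | n.top = N}.indicator fun n => c ^ N * hurwitzTerm ξ t s n)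
      (coeff N (hurwitzSeries r c ξ t s)) := by
  induction r generalizing c N with
  | zero =>
    have : Unique (DecreasingIndex 0) :=
      ⟨⟨⟨Fin.elim0, fun i => i.elim0, fun i => i.elim0⟩⟩,
        fun n => Subtype.ext (Subsingleton.elim _ _)⟩
    convert hasSum_unique (_ : DecreasingIndex 0 → ℂ) using 1
    rw [hurwitzSeries, coeff_one]
    by_cases hN : N = 0
    · subst hN; simp [DecreasingIndex.top, hurwitzTerm]
    · simp [DecreasingIndex.top, hurwitzTerm, hN, Ne.symm hN]
  | succ r ih =>
    rw [hurwitzSeries, coeff_divSeries, coeff_geomSeries_mul, Finset.sum_div]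
    set g : {m : DecreasingIndex r // m.top < N} → DecreasingIndex (r + 1) := fun m => m.1.cons m.2
    have hg : Function.Injective g := fun m m' h => by
      have h1 : Fin.cons N m.1.1 = (Fin.cons N m'.1.1 : Fin (r + 1) → ℕ) := congrArg Subtype.val h
      exact Subtype.ext (Subtype.ext (Fin.cons_right_injective _ h1))
    rw [← hg.hasSum_iff]
    · have h1 := hasSum_sum (s := Finset.range N) fun k _ => (((ih (c * ξ 0) (Fin.tail ξ)
        (Fin.tail t) (Fin.tail s) k).mul_left ((c * ξ 0) ^ (N - k))).div_const
          ((((N : ℝ) - t 0 : ℝ) : ℂ) ^ s 0))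
      have h2 : {n : DecreasingIndex (r + 1) | n.top = N}.indicator
          (fun n => c ^ N * hurwitzTerm ξ t s n) ∘ g = (fun m : DecreasingIndex r => c ^ N * (ξ 0 ^ N /
          (((N : ℝ) - t 0 : ℝ) : ℂ) ^ s 0 *
            hurwitzTerm (Fin.tail ξ) (Fin.tail t) (Fin.tail s) m)) ∘
              (Subtype.val : {m : DecreasingIndex r | m.top < N} → DecreasingIndex r) := by
        funext m
        exact (Set.indicator_of_mem (s := {n : DecreasingIndex (r + 1) | n.top = N})
          (show (g m).top = N from rfl) _).trans (congrArg _ (hurwitzTerm_cons ξ t s m.1 m.2))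
      refine Eq.mp (congrArg (HasSum · _) h2.symm) ?_
      refine (hasSum_subtype_iff_indicator (s := {m : DecreasingIndex r | m.top < N})).2 ?_
      refine Eq.mpr (congrArg (HasSum · _) (funext fun m => ?_)) h1
      by_cases hm : m.top < N
      -- Only `k = m.top` contributes, and `(c * ξ 0) ^ (N - k)` times `(c * ξ 0) ^ k` restores the
      -- `N`-th power.
      · rw [Set.indicator_of_mem (by exact hm), Finset.sum_eq_single_of_mem m.top
          (Finset.mem_range.2 hm)]
        · rw [Set.indicator_of_mem (by exact rfl), ← mul_assoc ((c * ξ 0) ^ _),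
            ← pow_add, Nat.sub_add_cancel hm.le, mul_pow]
          ring
        · intro k _ hk
          rw [Set.indicator_of_notMem (by exact hk.symm)]
          simp
      · rw [Set.indicator_of_notMem (by exact hm), Finset.sum_eq_zero]
        intro k hk
        rw [Set.indicator_of_notMem]
        · simp
        · have := Finset.mem_range.1 hk
          simp only [Set.mem_ofPred_eq]
          omega
    · intro n hn
      refine Set.indicator_of_notMem (fun h => hn ?_) _
      obtain ⟨m, hm, hnm⟩ := n.exists_eq_cons
      obtain rfl : n.top = N := h
      exact ⟨⟨m, hm⟩, hnm.symm⟩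

lemma summable_norm_coeff_hurwitzSeries {r : ℕ} {ξ : Fin r → ℂ} {t : Fin r → ℝ} {s : Fin r → ℕ}
    (h : Summable (hurwitzTerm ξ t s)) :
    (Summable fun N => ‖coeff N (hurwitzSeries r 1 ξ t s)‖) ∧
      ∑' N, coeff N (hurwitzSeries r 1 ξ t s) = coloredHurwitz ξ t s := by
  have h1 : ∀ N, HasSum (fun n : {n : DecreasingIndex r // n.top = N} => hurwitzTerm ξ t s n)
      (coeff N (hurwitzSeries r 1 ξ t s)) := fun N => by
    have := hasSum_coeff_hurwitzSeries r 1 ξ t s N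
    simp only [one_pow, one_mul] at this
    exact (hasSum_subtype_iff_indicator (s := {n : DecreasingIndex r | n.top = N})).2 this
  have h2 := ((Equiv.sigmaFiberEquiv (DecreasingIndex.top (r := r))).hasSum_iff
    (f := hurwitzTerm ξ t s)).2 h.hasSum
  have h3 := h2.sigma h1
  exact ⟨summable_norm_iff.2 h3.summable, h3.tsum_eq⟩

/-! ### Absolute convergence -/

/-- Abel summation in the exponents: the product is one of partial products of the colors raised to
the nonnegative powers `n_i - n_{i+1}`. -/
lemma norm_pow_mul_prod_le_one (r : ℕ) (c : ℂ) (ξ : Fin r → ℂ) (hc : ‖c‖ ≤ 1)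
    (hξ : ∀ i, ‖c * ∏ k ∈ Finset.Iic i, ξ k‖ ≤ 1) (n : Fin r → ℕ) (hn : Antitone n) (M : ℕ)
    (hM : ∀ i, n i ≤ M) : ‖c ^ M * ∏ i, ξ i ^ n i‖ ≤ 1 := by
  induction r generalizing c M with
  | zero => simpa using pow_le_one₀ (norm_nonneg _) hc
  | succ r ih =>
    rw [Fin.forall_fin_succ, prod_Iic_fin_zero] at hξ
    simp only [prod_Iic_fin_succ, ← mul_assoc] at hξ
    have := ih (c * ξ 0) (Fin.tail ξ) hξ.1 hξ.2 (Fin.tail n)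
      (fun i j hij => hn (Fin.succ_le_succ_iff.2 hij)) (n 0) (fun i => hn (Fin.zero_le _))
    have e : c ^ M * ∏ i, ξ i ^ n i =
        c ^ (M - n 0) * ((c * ξ 0) ^ n 0 * ∏ i, Fin.tail ξ i ^ Fin.tail n i) := by
      rw [Fin.prod_univ_succ, mul_pow]
      conv_lhs => rw [← Nat.sub_add_cancel (hM 0), pow_add]
      simp only [Fin.tail]
      ring
    rw [e, norm_mul, norm_pow]
    exact mul_le_one₀ (pow_le_one₀ (norm_nonneg _) hc) (norm_nonneg _) this

/-- `N / (N - t)` tends to `1`, hence is bounded. At `N = t` the inverse is `0` by convention and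
the bound persists. -/
lemma exists_inv_abs_sub_le (t : ℝ) :
    ∃ C : ℝ, 0 < C ∧ ∀ N : ℕ, 0 < N → |(N : ℝ) - t|⁻¹ ≤ C * (N : ℝ)⁻¹ := by
  have h : Filter.Tendsto (fun N : ℕ => (N : ℝ) / ((N : ℝ) - t)) Filter.atTop (nhds 1) := by
    simpa [sub_eq_add_neg] using tendsto_natCast_div_add_atTop (𝕜 := ℝ) (-t)
  obtain ⟨C, hC⟩ := h.abs.bddAbove_range
  refine ⟨max C 1, by positivity, fun N hN => ?_⟩
  have hN' : (0 : ℝ) < N := by exact_mod_cast hN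
  have h1 : |(N : ℝ) / ((N : ℝ) - t)| ≤ max C 1 := (hC ⟨N, rfl⟩).trans (le_max_left _ _)
  rw [abs_div, abs_of_pos hN', div_eq_inv_mul] at h1
  rw [← div_eq_mul_inv, le_div_iff₀ hN']
  exact h1

lemma summable_prod_pi {a : ℕ → ℝ} (ha : ∀ n, 0 ≤ a n) (h : Summable a) (r : ℕ) :
    Summable fun n : Fin r → ℕ => ∏ i, a (n i) := by
  induction r with
  | zero => exact Summable.of_finite
  | succ r ih =>
    rw [← (Fin.consEquiv fun _ : Fin (r + 1) => ℕ).summable_iff]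
    have := h.mul_of_nonneg ih ha fun n => Finset.prod_nonneg fun i _ => ha _
    convert this using 1
    funext p
    simp [Fin.prod_univ_succ, Fin.consEquiv]

/-- In positive depth `r`, the extra factor `1 / n₁` coming from `s₁ > 1` is shared out: `1 / n₁ = ∏
n₁ ^ (-1/r) ≤ ∏ n_i ^ (-1/r)`. This leaves a product of `r` convergent series with exponent `1 +
1/r`. -/
lemma summable_prod_decreasingIndex (r : ℕ) (s : Fin r → ℕ)
    (hs : s ∈ convergentCompositions r) :
    Summable fun n : DecreasingIndex r => ∏ i, ((n.1 i : ℝ)⁻¹) ^ s i := by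
  cases r with
  | zero =>
    have : Subsingleton (DecreasingIndex 0) := ⟨fun a b => Subtype.ext (Subsingleton.elim _ _)⟩
    exact Summable.of_finite
  | succ r =>
    have hp : 1 < 1 + ((r + 1 : ℕ) : ℝ)⁻¹ := by
      have : (0 : ℝ) < ((r + 1 : ℕ) : ℝ)⁻¹ := by positivity
      linarith
    have h1 := (summable_prod_pi (fun n => by positivity)
      (Real.summable_nat_rpow_inv.2 hp) (r + 1)).comp_injective
        (Subtype.val_injective (p := fun n : Fin (r + 1) → ℕ => StrictAnti n ∧ ∀ i, 0 < n i))
    refine Summable.of_nonneg_of_le (fun n => by positivity) (fun n => ?_) h1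
    have hpos : ∀ i, (0 : ℝ) < n.1 i := fun i => by exact_mod_cast n.2.2 i
    have hone : ∀ i, (n.1 i : ℝ)⁻¹ ≤ 1 := fun i => inv_le_one_of_one_le₀ (by exact_mod_cast n.2.2 i)
    have h2 : ∏ i, ((n.1 i : ℝ)⁻¹) ^ s i ≤ (n.1 0 : ℝ)⁻¹ * ∏ i, (n.1 i : ℝ)⁻¹ := by
      rw [Fin.prod_univ_succ, Fin.prod_univ_succ, ← mul_assoc, ← pow_two]
      refine mul_le_mul ?_ ?_ (by positivity) (by positivity)
      · exact pow_le_pow_of_le_one (inv_nonneg.2 (hpos 0).le) (hone 0) (hs.2 (Nat.succ_pos r))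
      · refine Finset.prod_le_prod (fun i _ => by positivity) fun i _ => ?_
        exact pow_le_of_le_one (inv_nonneg.2 (hpos _).le) (hone _) (hs.1 _).ne'
    refine h2.trans ?_
    have h3 : ∀ i, ((n.1 i : ℝ) ^ (1 + ((r + 1 : ℕ) : ℝ)⁻¹))⁻¹ =
        ((n.1 i : ℝ)⁻¹) ^ (((r + 1 : ℕ) : ℝ)⁻¹) * (n.1 i : ℝ)⁻¹ := fun i => by
      rw [Real.rpow_add (hpos i), Real.rpow_one, mul_inv, Real.inv_rpow (hpos i).le, mul_comm]
    change _ ≤ ∏ i, ((n.1 i : ℝ) ^ (1 + ((r + 1 : ℕ) : ℝ)⁻¹))⁻¹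
    simp only [h3, Finset.prod_mul_distrib]
    refine mul_le_mul_of_nonneg_right ?_ (by positivity)
    have h4 : (n.1 0 : ℝ)⁻¹ = ∏ _i : Fin (r + 1), ((n.1 0 : ℝ)⁻¹) ^ (((r + 1 : ℕ) : ℝ)⁻¹) := by
      rw [Finset.prod_const, Finset.card_univ, Fintype.card_fin,
        Real.rpow_inv_natCast_pow (inv_nonneg.2 (hpos 0).le) (Nat.succ_ne_zero r)]
    rw [h4]
    refine Finset.prod_le_prod (fun i _ => by positivity) fun i _ => ?_
    refine Real.rpow_le_rpow (inv_nonneg.2 (hpos 0).le) ?_ (by positivity)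
    refine inv_anti₀ (hpos i) ?_
    exact_mod_cast n.2.1.antitone (Fin.zero_le i)

lemma summable_hurwitzTerm {r : ℕ} {ξ : Fin r → ℂ} (t : Fin r → ℝ) {s : Fin r → ℕ}
    (hξ : ∀ i, ‖∏ k ∈ Finset.Iic i, ξ k‖ ≤ 1) (hs : s ∈ convergentCompositions r) :
    Summable (hurwitzTerm ξ t s) := by
  choose C hC hCN using fun i => exists_inv_abs_sub_le (t i)
  refine Summable.of_norm_bounded
    ((summable_prod_decreasingIndex r s hs).mul_left (∏ i, C i ^ s i)) fun n => ?_
  have h1 := norm_pow_mul_prod_le_one r 1 ξ (by simp) (by simpa using hξ) n.1 n.2.1.antitone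
    (∑ i, n.1 i) fun i => Finset.single_le_sum (fun _ _ => Nat.zero_le _) (Finset.mem_univ i)
  rw [one_pow, one_mul] at h1
  rw [hurwitzTerm, Finset.prod_div_distrib, norm_div, ← Finset.prod_mul_distrib, div_eq_mul_inv]
  refine (mul_le_of_le_one_left (by positivity) h1).trans ?_
  rw [norm_prod, ← Finset.prod_inv_distrib]
  refine Finset.prod_le_prod (fun i _ => by positivity) fun i _ => ?_
  rw [norm_pow, Complex.norm_real, Real.norm_eq_abs, ← inv_pow, ← mul_pow]
  exact pow_le_pow_left₀ (by positivity) (hCN i _ (n.2.2 i)) _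

/-! ### The algebra of polyzetas -/

section Main

variable {𝒞 : Subgroup ℂˣ} {Q : ℕ → ℝ → Prop} {𝒯' : (r : ℕ) → Set (Fin r → ℝ)}

lemma isAdmissible_one_iff {r : ℕ} {ξ : Fin r → ℂ} {t : Fin r → ℝ} {s : Fin r → ℕ}
    (h𝒯' : ∀ r, 𝒯' r = {t | ∀ i : Fin r, Q (r - i) (t i)}) :
    IsAdmissible 𝒞 Q r 1 ξ t s ↔ ξ ∈ colorTuples 𝒞 r ∧ t ∈ 𝒯' r ∧ ∀ i, 0 < s i := by
  simp only [IsAdmissible, h𝒯', colorTuples, Set.mem_ofPred_eq, one_mul, forall_and]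
  tauto

lemma coeff_mem_span_polyzetas (A : Subring ℂ) (hQ : ShiftCondition Q)
    (h𝒯' : ∀ r, 𝒯' r = {t | ∀ i : Fin r, Q (r - i) (t i)}) {f : ℂ⟦X⟧}
    (hf : f ∈ Submodule.span A (convergentWordSeries 𝒞 Q)) :
    (Summable fun N => ‖coeff N f‖) ∧
      ∑' N, coeff N f ∈ Submodule.span A (polyzetas 1 𝒞 𝒯') := by
  induction hf using Submodule.span_induction with
  | mem f hf =>
    obtain ⟨r, ξ, t, s, h, hs, rfl⟩ := exists_eq_hurwitzSeries_of_mem_convergentWordSeries hQ hf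
    obtain ⟨h1, h2, h3⟩ := (isAdmissible_one_iff h𝒯').1 h
    have hs' : s ∈ convergentCompositions (r + 1) := ⟨h3, fun _ => hs⟩
    obtain ⟨h4, h5⟩ := summable_norm_coeff_hurwitzSeries (summable_hurwitzTerm t h1.2 hs')
    exact ⟨h4, h5 ▸ Submodule.subset_span ⟨r + 1, by omega, ξ, h1, t, h2, s, hs', rfl⟩⟩
  | zero => simp [summable_zero]
  | add f g _ _ hf hg =>
    refine ⟨(hf.1.add hg.1).of_nonneg_of_le (fun _ => norm_nonneg _) fun N => ?_, ?_⟩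
    · rw [map_add]; exact norm_add_le _ _
    · simp only [map_add]
      rw [hf.1.of_norm.tsum_add hg.1.of_norm]
      exact add_mem hf.2 hg.2
  | smul a f _ hf =>
    have h : ∀ N, coeff N (a • f) = (a : ℂ) * coeff N f := fun N => rfl
    simp only [h, norm_mul]
    refine ⟨hf.1.mul_left _, ?_⟩
    rw [tsum_mul_left]
    exact Submodule.smul_mem _ a hf.2

lemma mul_mem_span_polyzetas (A : Subring ℂ) (hQ : ShiftCondition Q)
    (h𝒯' : ∀ r, 𝒯' r = {t | ∀ i : Fin r, Q (r - i) (t i)}) {x y : ℂ}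
    (hx : x ∈ polyzetas 1 𝒞 𝒯') (hy : y ∈ polyzetas 1 𝒞 𝒯') :
    x * y ∈ Submodule.span A (polyzetas 1 𝒞 𝒯') := by
  have key : ∀ x ∈ polyzetas 1 𝒞 𝒯', ∃ f ∈ convergentWordSeries 𝒞 Q,
      (Summable fun N => ‖coeff N f‖) ∧ ∑' N, coeff N f = x := by
    rintro _ ⟨r, hr, ξ, hξ, t, ht, s, hs, rfl⟩
    obtain ⟨r, rfl⟩ : ∃ q, r = q + 1 := ⟨r - 1, by omega⟩
    exact ⟨_, hurwitzSeries_mem_convergentWordSeries r ξ t s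
      ((isAdmissible_one_iff h𝒯').2 ⟨hξ, ht, hs.1⟩) (hs.2 (Nat.succ_pos r)),
      summable_norm_coeff_hurwitzSeries (summable_hurwitzTerm t hξ.2 hs)⟩
  obtain ⟨f, hf, hf1, rfl⟩ := key x hx
  obtain ⟨g, hg, hg1, rfl⟩ := key y hy
  -- The product of the values is the value of the Cauchy product of the series.
  rw [tsum_mul_tsum_eq_tsum_sum_antidiagonal_of_summable_norm hf1 hg1]
  have := (coeff_mem_span_polyzetas A hQ h𝒯' (convergentWordSeries_mul_mem_span A hQ hf hg)).2
  simpa only [coeff_mul] using this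

lemma polyzetas_zero (h𝒯' : ∀ r, 𝒯' r = {t | ∀ i : Fin r, Q (r - i) (t i)}) :
    polyzetas 0 𝒞 𝒯' = insert 1 (polyzetas 1 𝒞 𝒯') := by
  have h0 : ∀ (ξ : Fin 0 → ℂ) t s, coloredHurwitz ξ t s = 1 := fun ξ t s => by
    have : Unique (DecreasingIndex 0) :=
      ⟨⟨⟨Fin.elim0, fun i => i.elim0, fun i => i.elim0⟩⟩,
        fun n => Subtype.ext (Subsingleton.elim _ _)⟩
    simp [coloredHurwitz, hurwitzTerm]
  ext z
  constructor
  · rintro ⟨r, -, ξ, hξ, t, ht, s, hs, rfl⟩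
    rcases Nat.eq_zero_or_pos r with rfl | hr
    · exact Or.inl (h0 _ _ _)
    · exact Or.inr ⟨r, hr, ξ, hξ, t, ht, s, hs, rfl⟩
  · rintro (rfl | ⟨r, hr, h⟩)
    · exact ⟨0, le_rfl, 0, ⟨fun i => i.elim0, fun i => i.elim0⟩, 0,
        by rw [h𝒯']; exact fun i => i.elim0, 0, ⟨fun i => i.elim0, fun h => absurd h (lt_irrefl _)⟩,
        (h0 _ _ _).symm⟩
    · exact ⟨r, Nat.zero_le _, h⟩

lemma mul_mem_span_of_mul_mem {R B : Type*} [CommRing R] [CommRing B] [Algebra R B] {S : Set B}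
    (h : ∀ x ∈ S, ∀ y ∈ S, x * y ∈ Submodule.span R S) {x y : B} (hx : x ∈ Submodule.span R S)
    (hy : y ∈ Submodule.span R S) : x * y ∈ Submodule.span R S := by
  have h1 : Submodule.span R S * Submodule.span R S ≤ Submodule.span R S := by
    rw [Submodule.span_mul_span, Submodule.span_le]
    rintro _ ⟨x, hx, y, hy, rfl⟩
    exact h x hx y hy
  exact h1 (Submodule.mul_mem_mul hx hy)

lemma nonUnitalAdjoin_eq_span_of_mul_mem {R B : Type*} [CommRing R] [CommRing B] [Algebra R B]
    {S : Set B} (h : ∀ x ∈ S, ∀ y ∈ S, x * y ∈ Submodule.span R S) :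
    (NonUnitalAlgebra.adjoin R S).toSubmodule = Submodule.span R S := by
  rw [NonUnitalAlgebra.adjoin_eq_span]
  refine le_antisymm (Submodule.span_le.2 fun x hx => ?_)
    (Submodule.span_mono Subsemigroup.subset_closure)
  induction hx using Subsemigroup.closure_induction with
  | mem x hx => exact Submodule.subset_span hx
  | mul x y _ _ hx hy => exact mul_mem_span_of_mul_mem h hx hy

lemma adjoin_eq_span_of_mul_mem {R B : Type*} [CommRing R] [CommRing B] [Algebra R B]
    {S : Set B} (h1 : 1 ∈ S) (h : ∀ x ∈ S, ∀ y ∈ S, x * y ∈ Submodule.span R S) :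
    Subalgebra.toSubmodule (Algebra.adjoin R S) = Submodule.span R S := by
  rw [Algebra.adjoin_eq_span]
  refine le_antisymm (Submodule.span_le.2 fun x hx => ?_)
    (Submodule.span_mono Submonoid.subset_closure)
  induction hx using Submonoid.closure_induction with
  | mem x hx => exact Submodule.subset_span hx
  | one => exact Submodule.subset_span h1
  | mul x y _ _ hx hy => exact mul_mem_span_of_mul_mem h hx hy

/-- The tuple `n i = r - i` (with `i` counted from `0`) is minimal in every entry, so positivity
need only be tested there. This turns it into a condition on depth and shift of suffixes. -/
lemma positiveTuples_eq (𝒯 : AddSubgroup ℝ) (r : ℕ) :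
    positiveTuples 𝒯 r =
      {t | ∀ i : Fin r, 0 < r - (i : ℕ) ∧ t i ∈ 𝒯 ∧ t i < ((r - (i : ℕ) : ℕ) : ℝ)} := by
  ext t
  constructor
  · rintro ⟨h1, h2⟩ i
    refine ⟨by omega, h1 i, ?_⟩
    exact h2 ⟨fun i => r - (i : ℕ), fun i j hij => by
      have : (i : ℕ) < j := hij
      simp only
      omega, fun i => by simp only; omega⟩ i
  · intro h
    refine ⟨fun i => (h i).2.1, fun n i => (h i).2.2.trans_le ?_⟩
    have key : ∀ k : ℕ, ∀ i : Fin r, r - (i : ℕ) = k + 1 → k + 1 ≤ n.1 i := by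
      intro k
      induction k with
      | zero => exact fun i _ => n.2.2 i
      | succ k ih =>
        intro i hi
        have h1 := ih ⟨i + 1, by omega⟩ (by simp only; omega)
        have h2 : n.1 ⟨i + 1, by omega⟩ < n.1 i := n.2.1 (Fin.lt_def.2 (Nat.lt_succ_self _))
        omega
    have := key (r - i - 1) i (by omega)
    exact_mod_cast (by omega : r - (i : ℕ) ≤ n.1 i)

lemma polyzetas_generate (A : Subring ℂ) (hQ : ShiftCondition Q)
    (h𝒯' : ∀ r, 𝒯' r = {t | ∀ i : Fin r, Q (r - i) (t i)}) :
    (NonUnitalAlgebra.adjoin A (polyzetas 1 𝒞 𝒯')).toSubmodule =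
      Submodule.span A (polyzetas 1 𝒞 𝒯') ∧
    Subalgebra.toSubmodule (Algebra.adjoin A (polyzetas 0 𝒞 𝒯')) =
      Submodule.span A (polyzetas 0 𝒞 𝒯') := by
  have h1 : ∀ x ∈ polyzetas 1 𝒞 𝒯', ∀ y ∈ polyzetas 1 𝒞 𝒯',
      x * y ∈ Submodule.span A (polyzetas 1 𝒞 𝒯') :=
    fun x hx y hy => mul_mem_span_polyzetas A hQ h𝒯' hx hy
  refine ⟨nonUnitalAdjoin_eq_span_of_mul_mem h1, ?_⟩
  rw [polyzetas_zero h𝒯']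
  refine adjoin_eq_span_of_mul_mem (Set.mem_insert _ _) ?_
  rintro x (rfl | hx) y hy
  · rw [one_mul]; exact Submodule.subset_span hy
  · rcases hy with rfl | hy
    · rw [mul_one]; exact Submodule.subset_span (Or.inr hx)
    · exact Submodule.span_mono (Set.subset_insert _ _) (h1 x hx y hy)

end Main

theorem mainTheorem9 (T : Set ℝ) (𝒯 : AddSubgroup ℝ) (h𝒯 : 𝒯 = AddSubgroup.closure T)
    (𝒞 : Subgroup ℂˣ) (A : Subring ℂ)
    (𝒯' : (r : ℕ) → Set (Fin r → ℝ))
    (h𝒯' : 𝒯' = positiveTuples 𝒯 ∨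
      (𝒯' = allTuples 𝒯 ∧ ∀ n : ℕ, 0 < n → (n : ℝ) ∉ 𝒯)) :
    -- all the series converge absolutely
    (∀ (r : ℕ), ∀ ξ ∈ colorTuples 𝒞 r, ∀ t ∈ 𝒯' r, ∀ s ∈ convergentCompositions r,
      Summable fun n : DecreasingIndex r => hurwitzTerm ξ t s n) ∧
    -- algebras without unit, polyzetas of positive depth
    (NonUnitalAlgebra.adjoin A (polyzetas 1 𝒞 𝒯')).toSubmodule =
      Submodule.span A (polyzetas 1 𝒞 𝒯') ∧
    -- algebras with unit, the polyzeta of depth zero (equal to 1) included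
    Subalgebra.toSubmodule (Algebra.adjoin A (polyzetas 0 𝒞 𝒯')) =
      Submodule.span A (polyzetas 0 𝒞 𝒯') := by
  refine ⟨fun r ξ hξ t _ s hs => summable_hurwitzTerm t hξ.2 hs, ?_⟩
  rcases h𝒯' with rfl | ⟨rfl, h⟩
  -- The bounds `t < d` add up under products, and `t < d ≤ N` excludes `N = t`.
  · refine polyzetas_generate (Q := fun d t => 0 < d ∧ t ∈ 𝒯 ∧ t < (d : ℝ)) A
      ⟨fun h => h.1, fun h N hN => ?_, fun h h' => ⟨?_, ?_, ?_⟩⟩ (positiveTuples_eq 𝒯)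
    · exact (h.2.2.trans_le (by exact_mod_cast hN)).ne'
    · exact Nat.add_pos_left h.1 _
    · exact add_mem h.2.1 h'.2.1
    · push_cast; exact add_lt_add h.2.2 h'.2.2
  -- Here `N ≥ d > 0` is a positive integer, so it cannot equal a shift in `𝒯`.
  · refine polyzetas_generate (Q := fun d t => 0 < d ∧ t ∈ 𝒯) A
      ⟨fun h => h.1, fun h' N hN e => ?_, fun h h' => ⟨?_, ?_⟩⟩ fun r => ?_
    · exact h N (h'.1.trans_le hN) (e ▸ h'.2)
    · exact Nat.add_pos_left h.1 _
    · exact add_mem h.2 h'.2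
    · ext t
      exact forall_congr' fun i => ⟨fun h => ⟨by omega, h⟩, fun h => h.2⟩
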